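/- Let $q$ be a prime power, $m\ge 1$, and let $\mathcal C$ be a non-degenerate $[n,k,d]_{q^m/q}$ rank-metric code, that is, a $k$-dimensional $\mathbb F_{q^m}$-subspace of $\mathbb F_{q^m}^n$ with minimum rank distance $d$, where the rank weight of a vector is the $\mathbb F_q$-dimension of the span of its entries, and where non-degenerate means that the $\mathbb F_q$-span of the columns of any generator matrix has dimension $n$. Let $U\subseteq\mathbb F_{q^m}^k$ be a system associated with $\mathcal C$, i.e. the $\mathbb F_q$-span of the columns of a generator matrix of $\mathcal C$. Let $A_i$ be the number of codewords of weight $i$. Let $\sigma$ be a non-degenerate reflexive sesquilinear form on $\mathbb F_{q^m}^k$ (semilinear in its first argument, linear in its second), and put $U^{\perp}=\{v : \mathrm{Tr}_{q^m/q}(\sigma(u,v))=0 \text{ for all } u\in U\}$. For an $\mathbb F_q$-subspace $T$ of $\mathbb F_{q^m}^k$ let $L_T=\{\langle t\rangle_{\mathbb F_{q^m}} : t\in T\setminus\{0\}\}\subseteq \mathrm{PG}(k-1,q^m)$, of rank $\dim_{\mathbb F_q}T$; the weight of a point $\langle v\rangle_{\mathbb F_{q^m}}$ is $\dim_{\mathbb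 F_q}(T\cap\langle v\rangle_{\mathbb F_{q^m}})$, and $L_T$ is an $i$-club if one of its points has weight $i$ and all its other points have weight one. Then $\mathcal C$ is a three-weight code (its nonzero codewords have exactly three distinct weights) with $A_m\neq 0$, $A_{m-1}\neq0$ and $A_d=q^m-1$ if and only if $d\le m-2$ and $L_{U^\perp}$ is an $(m-d)$-club of rank $km-n$ in $\mathrm{PG}(k-1,q^m)$ with more than one point. In particular, in this case $$ n\ \ge\ \begin{cases} \dfrac{mk}{2} & \text{if } d\ge m/2 \text{ or } k=2,\\[2mm] \dfrac{m(k+1)}{2}-m+d & \text{if } 1\le d\le m/2.\end{cases}$$ -/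

import Mathlib

open scoped LinearAlgebra.Projectivization

namespace RankMetric

section LinearSets

variable {F K V : Type*} [Field F] [Field K] [Algebra F K]
  [AddCommGroup V] [Module F V] [Module K V] [IsScalarTower F K V]

/-- The `F`-linear set `L_U = {⟨u⟩_K : u ∈ U, u ≠ 0}` in the projective space `PG(V, K)`. -/
def linearSet (K : Type*) [Field K] [Module K V] (U : Submodule F V) : Set (ℙ K V) :=
  {P | ∃ u ∈ U, ∃ hu : u ≠ 0, P = Projectivization.mk K u hu}

/-- The rank of the linear set `L_U`, i.e. `dim_F U`. -/
noncomputable def linearSetRank (U : Submodule F V) : ℕ :=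
  Module.finrank F U

/-- The weight `dim_F (U ∩ ⟨v⟩_K)` of the point `P = ⟨v⟩_K` in the linear set `L_U`. -/
noncomputable def pointWeight (U : Submodule F V) (P : ℙ K V) : ℕ :=
  Module.finrank F ↥(U ⊓ P.submodule.restrictScalars F)

/-- `L_U` is an `i`-club: one point of `L_U` has weight `i` and all the other points of `L_U`
have weight one. -/
def IsClub (K : Type*) [Field K] [Algebra F K] [Module K V] [IsScalarTower F K V]
    (i : ℕ) (U : Submodule F V) : Prop :=
  ∃ P ∈ linearSet K U, pointWeight U P = i ∧
    ∀ Q ∈ linearSet K U, Q ≠ P → pointWeight U Q = 1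

/-- The orthogonal complement of the `F`-subspace `U` of `V` with respect to
`(u, v) ↦ Tr_{K/F}(σ(u, v))`, where `σ` is a sesquilinear form on the `K`-space `V`
(semilinear in the first variable, linear in the second). -/
noncomputable def traceDual {τ : K →+* K} (σ : V →ₛₗ[τ] V →ₗ[K] K) (U : Submodule F V) :
    Submodule F V where
  carrier := {v | ∀ u ∈ U, Algebra.trace F K (σ u v) = 0}
  zero_mem' := by
    intro u _
    simp
  add_mem' := by
    intro a b ha hb u hu
    rw [map_add, map_add, ha u hu, hb u hu, add_zero]
  smul_mem' := by
    intro c v hv u hu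
    rw [← algebraMap_smul K c v, map_smul, algebraMap_smul, map_smul, hv u hu, smul_zero]

end LinearSets

section Codes

variable (F : Type*) {K : Type*} [Field F] [Field K] [Algebra F K]

/-- The rank weight `dim_F ⟨v_1, …, v_n⟩_F` of a vector `v ∈ K^n`. -/
noncomputable def rankWeight {n : ℕ} (v : Fin n → K) : ℕ :=
  Module.finrank F ↥(Submodule.span F (Set.range v))

/-- `C` is an `[n, k, d]` code for `K / F`: a `k`-dimensional `K`-subspace of `K^n` with minimum
rank distance `d`. -/
structure IsCode (n k d : ℕ) (C : Submodule K (Fin n → K)) : Prop where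
  finrank_eq : Module.finrank K C = k
  minDist : IsLeast {w : ℕ | ∃ x ∈ C, ∃ y ∈ C, x ≠ y ∧ w = rankWeight F (x - y)} d

/-- The number `A_i(C)` of codewords of rank weight `i`. -/
noncomputable def weightCount {n : ℕ} (C : Submodule K (Fin n → K)) (i : ℕ) : ℕ :=
  {c : Fin n → K | c ∈ C ∧ rankWeight F c = i}.ncard

/-- The set of rank weights of the nonzero codewords of `C`. -/
def nonzeroWeights {n : ℕ} (C : Submodule K (Fin n → K)) : Set ℕ :=
  {w | ∃ c ∈ C, c ≠ 0 ∧ w = rankWeight F c}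

/-- `C` is a three-weight code: its nonzero codewords have exactly three distinct weights. -/
def IsThreeWeight {n : ℕ} (C : Submodule K (Fin n → K)) : Prop :=
  (nonzeroWeights F C).ncard = 3

/-- `G` is a generator matrix of `C`: its rows form a `K`-basis of `C`. -/
def IsGeneratorMatrix {n k : ℕ} (C : Submodule K (Fin n → K)) (G : Matrix (Fin k) (Fin n) K) :
    Prop :=
  LinearIndependent K G.row ∧ Submodule.span K (Set.range G.row) = C

/-- The `F`-span in `K^k` of the columns of a matrix. -/
def columnSpan {n k : ℕ} (G : Matrix (Fin k) (Fin n) K) : Submodule F (Fin k → K) :=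
  Submodule.span F (Set.range G.col)

/-- `C` (of length `n`) is non-degenerate: the `F`-span of the columns of any generator matrix of
`C` has dimension `n`. -/
def IsNondegenerate {n : ℕ} (C : Submodule K (Fin n → K)) : Prop :=
  ∀ G : Matrix (Fin (Module.finrank K C)) (Fin n) K,
    IsGeneratorMatrix C G → Module.finrank F (columnSpan F G) = n

/-- `U` is a system associated with `C`: the `F`-span of the columns of some generator matrix
of `C`. -/
def IsAssociatedSystem {n k : ℕ} (C : Submodule K (Fin n → K)) (U : Submodule F (Fin k → K)) :
    Prop :=
  ∃ G : Matrix (Fin k) (Fin n) K, IsGeneratorMatrix C G ∧ U = columnSpan F G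

/-- `C` is a three-weight code with `A_m ≠ 0`, `A_{m-1} ≠ 0` and `A_d = q^m - 1`, where
`q = |F|` and `m = [K : F]`. -/
def IsClubTypeCode {n : ℕ} (q m d : ℕ) (C : Submodule K (Fin n → K)) : Prop :=
  IsThreeWeight F C ∧ weightCount F C m ≠ 0 ∧ weightCount F C (m - 1) ≠ 0 ∧
    weightCount F C d = q ^ m - 1

end Codes

end RankMetric

/-! Up to semilinear bijections `σ` is the dot product, so each vector `v` of the dual space encodes
a codeword `e v`, and `v` lies in `T = traceDual σ U` exactly when every entry of `e v` has trace
zero. Rescaling `v` gives the dictionary `pointWeight_eq`: the point of `v` has weight `m -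
rankWeight (e v)`. Codewords of weight `m`, `m - 1`, `d` thus correspond to points off `L_T`, of
weight one, and of weight `m - d`; `A_d = q^m - 1` says that the last kind is a single point. The
one thing the club condition does not give at once is a codeword of weight `m`; a double count
modulo `q^(m-d+1)` supplies it (`exists_rankWeight_eq_finrank`).

For the bounds, choose `a ∉ F` and send a codeword to the traces of its entries and of `a` times its
entries. The target has dimension `2n`. A codeword in the kernel has weight at most `m - 2`, so it
is a multiple `x • c₀` of a fixed word of weight `d`. Counting quotients (`exists_inf_mul_trivial`)
gives an `a` for which the admissible `x` form a small space. -/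

namespace RankMetric

/-! ### Trace duality in a finite field extension. -/

section TraceOrthogonal

variable {F K : Type*} [Field F] [Field K] [Algebra F K]

/-- The trace is a sum of powers, so it commutes with `τ` even when `τ` is not `F`-linear. -/
theorem trace_eq_zero_iff_of_ringHom [Finite K] (τ : K →+* K) (z : K) :
    Algebra.trace F K (τ z) = 0 ↔ Algebra.trace F K z = 0 := by
  have key : algebraMap F K (Algebra.trace F K (τ z))
      = τ (algebraMap F K (Algebra.trace F K z)) := by
    rw [FiniteField.algebraMap_trace_eq_sum_pow, FiniteField.algebraMap_trace_eq_sum_pow, map_sum]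
    simp
  rw [← map_eq_zero (algebraMap F K), key, map_eq_zero, map_eq_zero]

/-- The orthogonal complement of an `F`-subspace of `K` with respect to the trace form. -/
noncomputable def traceOrthogonal (I : Submodule F K) : Submodule F K :=
  LinearMap.BilinForm.orthogonal (Algebra.traceForm F K) I

theorem mem_traceOrthogonal {I : Submodule F K} {x : K} :
    x ∈ traceOrthogonal I ↔ ∀ y ∈ I, Algebra.trace F K (x * y) = 0 := by
  simp only [traceOrthogonal, LinearMap.BilinForm.mem_orthogonal_iff, Algebra.traceForm_apply,
    mul_comm x]

theorem mem_traceOrthogonal_span {s : Set K} {x : K} :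
    x ∈ traceOrthogonal (Submodule.span F s) ↔ ∀ y ∈ s, Algebra.trace F K (x * y) = 0 := by
  rw [mem_traceOrthogonal]
  refine ⟨fun h y hy => h y (Submodule.subset_span hy), fun h y hy => ?_⟩
  induction hy using Submodule.span_induction with
  | mem y hy => exact h y hy
  | zero => simp
  | add y z _ _ hy hz => rw [mul_add, map_add, hy, hz, add_zero]
  | smul c y _ hy => rw [mul_smul_comm, map_smul, hy, smul_zero]

theorem finrank_add_finrank_traceOrthogonal [Finite F] [Finite K] (I : Submodule F K) :
    Module.finrank F I + Module.finrank F (traceOrthogonal I) = Module.finrank F K := by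
  have h := LinearMap.BilinForm.finrank_orthogonal (traceForm_nondegenerate F K) I
  have := I.finrank_le
  rw [traceOrthogonal]
  omega

/-- A subspace `J` of dimension at most half that of the field has a multiple that meets it
trivially: the quotients of nonzero elements of `J` do not exhaust the nonzero scalars. -/
theorem exists_inf_mul_trivial [Finite F] [Finite K] (J : Submodule F K)
    (hJ : 2 * Module.finrank F J ≤ Module.finrank F K) :
    ∃ a : K, a ≠ 0 ∧ ∀ x ∈ J, a * x ∈ J → x = 0 := by
  classical
  by_contra! hcon
  let S : Set (J × J) := {p | p.1 ≠ 0 ∧ p.2 ≠ 0}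
  have hsub : {a : K | a ≠ 0} ⊆ (fun p : J × J => (p.1 : K) / p.2) '' S := by
    intro a ha
    obtain ⟨x, hx, hax, hx0⟩ := hcon a ha
    refine ⟨(⟨a * x, hax⟩, ⟨x, hx⟩), ⟨?_, ?_⟩, ?_⟩
    · simpa [Subtype.ext_iff] using And.intro ha hx0
    · simpa [Subtype.ext_iff] using hx0
    · simp [hx0]
  have h1 : ({a : K | a ≠ 0}).ncard ≤ S.ncard :=
    (Set.ncard_le_ncard hsub (Set.toFinite _)).trans (Set.ncard_image_le (Set.toFinite _))
  have hS : S = {x : J | x ≠ 0} ×ˢ {x : J | x ≠ 0} := by ext; simp [S]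
  have hc : ∀ (W : Type _) [AddCommGroup W] [Finite W],
      ({x : W | x ≠ 0}).ncard = Nat.card W - 1 := by
    intro W _ _
    have : {x : W | x ≠ 0} = ({0} : Set W)ᶜ := by ext; simp
    rw [this, Set.ncard_compl, Set.ncard_singleton]
  rw [hS, Set.ncard_prod, hc J, hc K] at h1
  -- With `|J| = j + 1`, covering all nonzero scalars by quotients forces `|K| - 1 ≤ j²`, whereas
  -- `|K| ≥ (j + 1)²`.
  have hle : Nat.card J * Nat.card J ≤ Nat.card K := by
    rw [Module.natCard_eq_pow_finrank (K := F) (V := J),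
      Module.natCard_eq_pow_finrank (K := F) (V := K), ← pow_add, ← two_mul]
    exact Nat.pow_le_pow_right Nat.card_pos hJ
  have hK1 : 1 < Nat.card K := Finite.one_lt_card
  have hJ1 : 0 < Nat.card J := Nat.card_pos
  obtain ⟨j, hj⟩ : ∃ j, Nat.card J = j + 1 := ⟨Nat.card J - 1, by omega⟩
  rw [hj] at h1 hle
  have : j = 0 ∨ 0 < j := by omega
  simp only [Nat.add_sub_cancel] at h1
  rcases this with rfl | h
  · omega
  · have : (j + 1) * (j + 1) = j * j + 2 * j + 1 := by ring
    omega

end TraceOrthogonal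

/-! ### Elementary properties of the rank weight. -/

section RankWeight

variable {F K : Type*} [Field F] [Field K] [Algebra F K] {n : ℕ}

theorem rankWeight_le_length (v : Fin n → K) : rankWeight F v ≤ n := by
  simpa [rankWeight, Set.finrank] using finrank_range_le_card (R := F) v

theorem rankWeight_le_finrank [Module.Finite F K] (v : Fin n → K) :
    rankWeight F v ≤ Module.finrank F K :=
  Submodule.finrank_le _

theorem rankWeight_eq_zero_iff [Module.Finite F K] {v : Fin n → K} :
    rankWeight F v = 0 ↔ v = 0 := by
  rw [rankWeight, Submodule.finrank_eq_zero, Submodule.span_eq_bot]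
  constructor
  · intro h
    ext j
    exact h _ ⟨j, rfl⟩
  · rintro rfl _ ⟨j, rfl⟩
    rfl

theorem rankWeight_zero [Module.Finite F K] : rankWeight F (0 : Fin n → K) = 0 :=
  rankWeight_eq_zero_iff.2 rfl

theorem finrank_map_mulLeft {a : K} (ha : a ≠ 0) (I : Submodule F K) :
    Module.finrank F (I.map (LinearMap.mulLeft F a)) = Module.finrank F I :=
  LinearEquiv.finrank_map_eq (LinearEquiv.ofBijective (LinearMap.mulLeft F a)
    ⟨mul_right_injective₀ ha, fun y => ⟨a⁻¹ * y, by simp [ha]⟩⟩) I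

theorem rankWeight_smul {a : K} (ha : a ≠ 0) (v : Fin n → K) :
    rankWeight F (a • v) = rankWeight F v := by
  have h : Submodule.span F (Set.range (a • v)) =
      (Submodule.span F (Set.range v)).map (LinearMap.mulLeft F a) := by
    rw [Submodule.map_span, ← Set.range_comp]
    rfl
  rw [rankWeight, rankWeight, h]
  exact finrank_map_mulLeft ha _

end RankWeight

/-! ### Weights of club-type codes and the lower bounds on the length. -/

section ClubTypeCodes

variable {F K : Type*} [Field F] [Field K] [Algebra F K]
  {q m n k d : ℕ} {C : Submodule K (Fin n → K)}

theorem IsCode.exists_rankWeight_eq (hC : IsCode F n k d C) :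
    ∃ c ∈ C, c ≠ 0 ∧ rankWeight F c = d := by
  obtain ⟨x, hx, y, hy, hxy, hd⟩ := hC.minDist.1
  exact ⟨x - y, C.sub_mem hx hy, sub_ne_zero.2 hxy, hd.symm⟩

theorem IsCode.le_rankWeight (hC : IsCode F n k d C) {c : Fin n → K} (hc : c ∈ C) (h0 : c ≠ 0) :
    d ≤ rankWeight F c :=
  hC.minDist.2 ⟨c, hc, 0, C.zero_mem, h0, by rw [sub_zero]⟩

theorem IsCode.dim_pos (hC : IsCode F n k d C) : 0 < k := by
  obtain ⟨c, hc, h0, -⟩ := hC.exists_rankWeight_eq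
  rw [← hC.finrank_eq]
  exact Module.finrank_pos_iff_exists_ne_zero.2 ⟨⟨c, hc⟩, by simpa [Subtype.ext_iff] using h0⟩

theorem exists_of_weightCount_ne_zero {i : ℕ} (h : weightCount F C i ≠ 0) :
    ∃ c ∈ C, rankWeight F c = i :=
  Set.nonempty_of_ncard_ne_zero h

/-- Coordinatewise, the pair of traces `(Tr x, Tr (a x))`. -/
noncomputable def tracePair (a : K) (C : Submodule K (Fin n → K)) :
    C →ₗ[F] (Fin n → F) × (Fin n → F) :=
  (((Algebra.trace F K).compLeft (Fin n)).prod
    ((Algebra.trace F K ∘ₗ LinearMap.mulLeft F a).compLeft (Fin n))) ∘ₗ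
      C.subtype.restrictScalars F

theorem tracePair_eq_zero_iff {a : K} {c : C} :
    tracePair (F := F) a C c = 0 ↔ ∀ j, Algebra.trace F K ((c : Fin n → K) j) = 0 ∧
      Algebra.trace F K (a * (c : Fin n → K) j) = 0 := by
  simp [tracePair, Prod.ext_iff, funext_iff, forall_and]

variable [Finite K]

theorem ncard_image_smul (hq : Nat.card F = q) (hm : Module.finrank F K = m)
    {c : Fin n → K} (h0 : c ≠ 0) :
    ((fun a : K => a • c) '' {a | a ≠ 0}).ncard = q ^ m - 1 := by
  have : {a : K | a ≠ 0} = ({0} : Set K)ᶜ := by ext; simp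
  rw [Set.ncard_image_of_injective _ (smul_left_injective K h0), this, Set.ncard_compl,
    Set.ncard_singleton, Module.natCard_eq_pow_finrank (K := F) (V := K), hq, hm]

theorem IsCode.pos (hC : IsCode F n k d C) : 0 < d := by
  obtain ⟨c, -, h0, rfl⟩ := hC.exists_rankWeight_eq
  exact Nat.pos_of_ne_zero fun h => h0 (rankWeight_eq_zero_iff.1 h)

theorem weightCount_ne_zero {c : Fin n → K} (hc : c ∈ C) :
    weightCount F C (rankWeight F c) ≠ 0 :=
  Set.ncard_ne_zero_of_mem (a := c) ⟨hc, rfl⟩ (Set.toFinite _)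

/-- The `q^m - 1` nonzero multiples of `c₀` already exhaust the words of its weight. -/
theorem exists_eq_smul_of_weightCount_eq (hq : Nat.card F = q) (hm : Module.finrank F K = m)
    {c₀ : Fin n → K} (hc₀ : c₀ ∈ C) (h0 : c₀ ≠ 0)
    (hcount : weightCount F C (rankWeight F c₀) = q ^ m - 1)
    {c : Fin n → K} (hc : c ∈ C) (hw : rankWeight F c = rankWeight F c₀) :
    ∃ a : K, c = a • c₀ := by
  have hsub : (fun a : K => a • c₀) '' {a | a ≠ 0} ⊆
      {c | c ∈ C ∧ rankWeight F c = rankWeight F c₀} := by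
    rintro _ ⟨a, ha, rfl⟩
    exact ⟨C.smul_mem a hc₀, rankWeight_smul ha c₀⟩
  have heq := Set.eq_of_subset_of_ncard_le hsub
    (by rw [ncard_image_smul hq hm h0]; exact hcount.le) (Set.toFinite _)
  obtain ⟨a, -, ha⟩ := heq.ge ⟨hc, hw⟩
  exact ⟨a, ha.symm⟩

theorem IsClubTypeCode.weights (hm : Module.finrank F K = m) (hC : IsCode F n k d C)
    (h : IsClubTypeCode F q m d C) :
    d + 2 ≤ m ∧ ∀ c ∈ C, c ≠ 0 →
      rankWeight F c = m ∨ rankWeight F c = m - 1 ∨ rankWeight F c = d := by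
  obtain ⟨h3, hAm, hAm1, -⟩ := h
  have hIcc : nonzeroWeights F C ⊆ Set.Icc d m := by
    rintro _ ⟨c, hc, h0, rfl⟩
    exact ⟨hC.le_rankWeight hc h0, hm ▸ rankWeight_le_finrank c⟩
  have hd := hC.pos
  have hcard : ∀ a b : ℕ, (Set.Icc a b).ncard = b + 1 - a := by
    intro a b
    rw [← Finset.coe_Icc, Set.ncard_coe_finset, Nat.card_Icc]
  -- Three distinct weights in `[d, m]` force `d + 2 ≤ m`, which makes `m`, `m - 1`, `d` distinct.
  have hle := Set.ncard_le_ncard hIcc (Set.finite_Icc _ _)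
  rw [h3, hcard] at hle
  have hmem : ∀ i, i ≠ 0 → weightCount F C i ≠ 0 → i ∈ nonzeroWeights F C := by
    intro i hi hA
    obtain ⟨c, hc, rfl⟩ := exists_of_weightCount_ne_zero hA
    exact ⟨c, hc, fun h => hi (h ▸ rankWeight_zero), rfl⟩
  have hsub : ({m, m - 1, d} : Set ℕ) ⊆ nonzeroWeights F C := by
    rintro i (rfl | rfl | rfl)
    · exact hmem _ (by omega) hAm
    · exact hmem _ (by omega) hAm1
    · obtain ⟨c, hc, h0, rfl⟩ := hC.exists_rankWeight_eq
      exact ⟨c, hc, h0, rfl⟩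
  have hncard : ({m, m - 1, d} : Set ℕ).ncard = 3 :=
    Set.ncard_eq_three.2 ⟨m, m - 1, d, by omega, by omega, by omega, rfl⟩
  refine ⟨by omega, fun c hc h0 => ?_⟩
  have heq := Set.eq_of_subset_of_ncard_le hsub (by rw [h3, hncard])
    ((Set.finite_Icc _ _).subset hIcc)
  exact heq.ge ⟨c, hc, h0, rfl⟩

variable [Finite F]

/-- The entries of `c` are trace-orthogonal to the two-dimensional space spanned by `1` and `a`. -/
theorem rankWeight_add_two_le (hm : Module.finrank F K = m) {a : K}
    (ha : ∀ x : F, algebraMap F K x ≠ a) {c : C} (hc : tracePair (F := F) a C c = 0) :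
    rankWeight F (c : Fin n → K) + 2 ≤ m := by
  rw [tracePair_eq_zero_iff] at hc
  have hle : Submodule.span F (Set.range (c : Fin n → K)) ≤
      traceOrthogonal (Submodule.span F (Set.range ![1, a])) := by
    rw [Submodule.span_le]
    rintro _ ⟨j, rfl⟩
    rw [SetLike.mem_coe, mem_traceOrthogonal_span]
    rintro _ ⟨i, rfl⟩
    fin_cases i
    · simpa using (hc j).1
    · simpa [mul_comm] using (hc j).2
  have hli : LinearIndependent F ![(1 : K), a] := by
    rw [LinearIndependent.pair_iff' one_ne_zero]
    intro x hx
    exact ha x (by rw [Algebra.algebraMap_eq_smul_one]; exact hx)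
  have h2 := finrank_span_eq_card hli
  have h3 := finrank_add_finrank_traceOrthogonal (Submodule.span F (Set.range ![(1 : K), a]))
  have h4 := Submodule.finrank_mono hle
  rw [Fintype.card_fin] at h2
  rw [rankWeight]
  omega

/-- Rank-nullity for `tracePair`: its kernel has no words of weight `m` or `m - 1`, so it consists
of multiples `x • c₀`, with both `x` and `a * x` orthogonal to the entries of `c₀`. The space `N` is
any bound for such `x`. -/
theorem IsClubTypeCode.mul_le_add_finrank (hq : Nat.card F = q) (hm : Module.finrank F K = m)
    (hC : IsCode F n k d C) (h : IsClubTypeCode F q m d C)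
    {c₀ : Fin n → K} (hc₀ : c₀ ∈ C) (h0 : c₀ ≠ 0) (hw : rankWeight F c₀ = d)
    {a : K} (ha : ∀ x : F, algebraMap F K x ≠ a) {N : Submodule F K}
    (hN : ∀ x ∈ traceOrthogonal (Submodule.span F (Set.range c₀)),
      a * x ∈ traceOrthogonal (Submodule.span F (Set.range c₀)) → x ∈ N) :
    m * k ≤ 2 * n + Module.finrank F N := by
  have hweights := (h.weights hm hC).2
  let f : K →ₗ[F] C := (LinearMap.toSpanSingleton K C ⟨c₀, hc₀⟩).restrictScalars F
  have hker : (tracePair (F := F) a C).ker ≤ N.map f := by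
    intro c hc
    have hc' : tracePair (F := F) a C c = 0 := hc
    have h2 := rankWeight_add_two_le hm ha hc'
    obtain ⟨x, hx⟩ : ∃ x : K, (c : Fin n → K) = x • c₀ := by
      by_cases hc0 : (c : Fin n → K) = 0
      · exact ⟨0, by rw [hc0, zero_smul]⟩
      · have hd : rankWeight F (c : Fin n → K) = d := by
          have := hweights c c.2 hc0
          omega
        exact exists_eq_smul_of_weightCount_eq hq hm hc₀ h0 (hw.symm ▸ h.2.2.2) c.2
          (hd.trans hw.symm)
    rw [tracePair_eq_zero_iff, hx] at hc'
    refine ⟨x, hN x ?_ ?_, Subtype.ext hx.symm⟩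
    · rw [mem_traceOrthogonal_span]
      rintro _ ⟨j, rfl⟩
      exact (hc' j).1
    · rw [mem_traceOrthogonal_span]
      rintro _ ⟨j, rfl⟩
      rw [mul_assoc]
      exact (hc' j).2
  have h1 := (Submodule.finrank_mono hker).trans (Submodule.finrank_map_le f N)
  have h2 := (tracePair (F := F) a C).finrank_range_add_finrank_ker
  have h3 := (tracePair (F := F) a C).range.finrank_le
  have h4 : Module.finrank F C = m * k := by
    rw [← Module.finrank_mul_finrank F K C, hm, hC.finrank_eq]
  rw [Module.finrank_prod, Module.finrank_fin_fun] at h3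
  omega

/-- The orthogonal of the entries of `c₀` has dimension `m - d ≤ m / 2`, so some `a` makes
`tracePair` injective. -/
theorem IsClubTypeCode.mul_le_two_mul_length (hq : Nat.card F = q) (hm : Module.finrank F K = m)
    (hC : IsCode F n k d C) (h : IsClubTypeCode F q m d C) (hmd : m ≤ 2 * d) :
    m * k ≤ 2 * n := by
  obtain ⟨c₀, hc₀, h0, hw⟩ := hC.exists_rankWeight_eq
  have hdm := (h.weights hm hC).1
  have hdim := finrank_add_finrank_traceOrthogonal (Submodule.span F (Set.range c₀))
  have hw' : Module.finrank F (Submodule.span F (Set.range c₀)) = d := hw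
  obtain ⟨a, -, ha⟩ := exists_inf_mul_trivial
    (traceOrthogonal (Submodule.span F (Set.range c₀))) (by omega)
  have haF : ∀ x : F, algebraMap F K x ≠ a := by
    rintro x rfl
    -- A scalar from `F` would preserve this space, which has dimension `m - d ≥ 2`.
    have hbot : traceOrthogonal (Submodule.span F (Set.range c₀)) = ⊥ :=
      (Submodule.eq_bot_iff _).2 fun y hy =>
        ha y hy (by rw [← Algebra.smul_def]; exact Submodule.smul_mem _ _ hy)
    rw [hbot, finrank_bot] at hdim
    omega
  have := h.mul_le_add_finrank hq hm hC hc₀ h0 hw haF (N := ⊥)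
    fun x hx hax => (Submodule.mem_bot F).2 (ha x hx hax)
  rwa [finrank_bot, add_zero] at this

/-- Here the span `I` of the entries is the small space: choose `a` with `I ∩ aI = 0`. The
admissible `x` are orthogonal to `I + aI`, which has dimension `2d`, leaving dimension `m - 2d` for
`N`. -/
theorem IsClubTypeCode.mul_add_two_mul_le (hq : Nat.card F = q) (hm : Module.finrank F K = m)
    (hC : IsCode F n k d C) (h : IsClubTypeCode F q m d C) (hmd : 2 * d ≤ m) :
    m * k + 2 * d ≤ 2 * n + m := by
  obtain ⟨c₀, hc₀, h0, hw⟩ := hC.exists_rankWeight_eq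
  set I := Submodule.span F (Set.range c₀) with hI
  have hw' : Module.finrank F I = d := hw
  obtain ⟨a, ha0, ha⟩ := exists_inf_mul_trivial I (by omega)
  have haF : ∀ x : F, algebraMap F K x ≠ a := by
    rintro x rfl
    have hbot : I = ⊥ :=
      (Submodule.eq_bot_iff _).2 fun y hy =>
        ha y hy (by rw [← Algebra.smul_def]; exact Submodule.smul_mem _ _ hy)
    rw [hbot, finrank_bot] at hw'
    exact hC.pos.ne hw'
  let M : Submodule F K := I ⊔ I.map (LinearMap.mulLeft F a)
  have hinf : I ⊓ I.map (LinearMap.mulLeft F a) = ⊥ := by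
    rw [Submodule.eq_bot_iff]
    rintro _ ⟨hy, x, hx, rfl⟩
    rw [ha x hx hy, map_zero]
  have hM : Module.finrank F M + Module.finrank F ↥(I ⊓ I.map (LinearMap.mulLeft F a)) =
      Module.finrank F I + Module.finrank F (I.map (LinearMap.mulLeft F a)) :=
    Submodule.finrank_sup_add_finrank_inf_eq I _
  rw [hinf, finrank_bot, finrank_map_mulLeft ha0] at hM
  have hMo := finrank_add_finrank_traceOrthogonal M
  have := h.mul_le_add_finrank hq hm hC hc₀ h0 hw haF (N := traceOrthogonal M) (by
    intro x hx hax
    rw [← hI, mem_traceOrthogonal] at hx hax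
    rw [mem_traceOrthogonal]
    intro y hy
    obtain ⟨y, hyI, _, ⟨z, hz, rfl⟩, rfl⟩ := Submodule.mem_sup.1 hy
    have hz' := hax z hz
    rw [mul_add, map_add, hx y hyI, zero_add, LinearMap.mulLeft_apply, ← mul_assoc, mul_comm x]
    exact hz')
  omega

end ClubTypeCodes

/-! ### The trace of the dot product. -/

section TraceDotForm

variable {F K : Type*} [Field F] [Field K] [Algebra F K] {k : ℕ}

/-- The `F`-bilinear form `(x, y) ↦ Tr (x · y)` on `K^k`. -/
noncomputable def traceDotForm (F K : Type*) [Field F] [Field K] [Algebra F K] (k : ℕ) :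
    LinearMap.BilinForm F (Fin k → K) :=
  LinearMap.mk₂ F (fun x y => Algebra.trace F K (x ⬝ᵥ y))
    (fun x y z => by rw [add_dotProduct, map_add])
    (fun c x y => by rw [smul_dotProduct, map_smul])
    (fun x y z => by rw [dotProduct_add, map_add])
    (fun c x y => by rw [dotProduct_smul, map_smul])

theorem traceDotForm_apply (x y : Fin k → K) :
    traceDotForm F K k x y = Algebra.trace F K (x ⬝ᵥ y) := rfl

theorem traceDotForm_nondegenerate [Finite F] [Finite K] :
    (traceDotForm F K k).Nondegenerate := by
  have hleft : (traceDotForm F K k).SeparatingLeft := by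
    intro x hx
    ext j
    refine (traceForm_nondegenerate F K).1 (x j) fun z => ?_
    have := hx (Pi.single j z)
    rwa [traceDotForm_apply, dotProduct_single] at this
  refine ⟨hleft, fun x hx => hleft x fun y => ?_⟩
  rw [traceDotForm_apply, dotProduct_comm]
  exact hx y

end TraceDotForm

/-! ### The dictionary between points of the dual linear set and codewords. -/

section DualEncoding

variable {F K : Type*} [Field F] [Field K] [Algebra F K] {n k : ℕ}

/-- A bijection `e` of `K^k` with the code `C`, semilinear for the inverse of `τ`, for which `T` is
the set of vectors whose codeword has entries of trace zero. -/
structure IsDualEncoding (τ : K →+* K) (C : Submodule K (Fin n → K))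
    (T : Submodule F (Fin k → K)) (e : (Fin k → K) → Fin n → K) : Prop where
  injective : Function.Injective e
  range_eq : Set.range e = C
  map_smul : ∀ a v, e (τ a • v) = a • e v
  mem_iff : ∀ v, v ∈ T ↔ ∀ j, Algebra.trace F K (e v j) = 0

/-- The sesquilinear form `σ` is the dot product up to semilinear bijections. -/
theorem exists_dotProduct_eq [Finite K] (τ : K →+* K)
    (σ : (Fin k → K) →ₛₗ[τ] (Fin k → K) →ₗ[K] K) (hσ : σ.Nondegenerate) :
    ∃ ψ : (Fin k → K) → Fin k → K, Function.Bijective ψ ∧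
      (∀ a v, ψ (τ a • v) = a • ψ v) ∧ ∀ u v, σ u v = τ (u ⬝ᵥ ψ v) := by
  have hτ : Function.Bijective τ := Finite.injective_iff_bijective.1 τ.injective
  let τe : K ≃+* K := RingEquiv.ofBijective τ hτ
  have hτe : ∀ x, τ (τe.symm x) = x := τe.apply_symm_apply
  -- The coordinates of `ψ v` are the values of `σ` on the standard basis, untwisted by `τ⁻¹`.
  have hσψ : ∀ u v, σ u v = τ (u ⬝ᵥ fun i => τe.symm (σ (Pi.single i 1) v)) := by
    intro u v
    conv_lhs => rw [pi_eq_sum_univ' u]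
    simp only [map_sum, LinearMap.sum_apply, LinearMap.map_smulₛₗ, LinearMap.smul_apply,
      dotProduct, map_mul, hτe, smul_eq_mul]
  refine ⟨fun v i => τe.symm (σ (Pi.single i 1) v), Finite.injective_iff_bijective.1 ?_, ?_, hσψ⟩
  · intro v w hvw
    rw [← sub_eq_zero]
    refine hσ.2 _ fun u => ?_
    rw [map_sub, hσψ, hσψ, sub_eq_zero]
    exact congrArg (fun x => τ (u ⬝ᵥ x)) hvw
  · intro a v
    ext i
    apply hτ.1
    simp only [map_smul, smul_eq_mul, Pi.smul_apply, map_mul, hτe]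

theorem mem_traceDual_span [Finite K] {τ : K →+* K}
    {σ : (Fin k → K) →ₛₗ[τ] (Fin k → K) →ₗ[K] K} {ψ : (Fin k → K) → Fin k → K}
    (hψ : ∀ u v, σ u v = τ (u ⬝ᵥ ψ v)) {U : Submodule F (Fin k → K)} {v : Fin k → K} :
    v ∈ traceDual σ U ↔ ψ v ∈ (traceDotForm F K k).orthogonal U := by
  rw [LinearMap.BilinForm.mem_orthogonal_iff]
  refine forall₂_congr fun u _ => ?_
  rw [hψ, trace_eq_zero_iff_of_ringHom]
  rfl

/-- Since `ψ` is only semilinear, possibly not `F`-linear, dimensions are compared through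
cardinalities. -/
theorem finrank_traceDual [Finite F] [Finite K] (τ : K →+* K)
    (σ : (Fin k → K) →ₛₗ[τ] (Fin k → K) →ₗ[K] K) (hσ : σ.Nondegenerate)
    (U : Submodule F (Fin k → K)) :
    Module.finrank F (traceDual σ U) = k * Module.finrank F K - Module.finrank F U := by
  obtain ⟨ψ, hbij, -, hψ⟩ := exists_dotProduct_eq τ σ hσ
  have hcard : Nat.card (traceDual σ U) = Nat.card ((traceDotForm F K k).orthogonal U) :=
    Nat.card_congr ((Equiv.ofBijective ψ hbij).subtypeEquiv fun v => mem_traceDual_span hψ)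
  rw [Module.natCard_eq_pow_finrank (K := F), Module.natCard_eq_pow_finrank (K := F)
    (V := (traceDotForm F K k).orthogonal U)] at hcard
  rw [Nat.pow_right_injective (Finite.one_lt_card (α := F)) hcard,
    LinearMap.BilinForm.finrank_orthogonal traceDotForm_nondegenerate, Module.finrank_pi_fintype]
  simp

theorem exists_isDualEncoding [Finite K] (τ : K →+* K)
    (σ : (Fin k → K) →ₛₗ[τ] (Fin k → K) →ₗ[K] K) (hσ : σ.Nondegenerate)
    {C : Submodule K (Fin n → K)} {G : Matrix (Fin k) (Fin n) K} (hG : IsGeneratorMatrix C G) :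
    ∃ e, IsDualEncoding τ C (traceDual σ (columnSpan F G)) e := by
  obtain ⟨ψ, hbij, hsmul, hψ⟩ := exists_dotProduct_eq τ σ hσ
  have hinj : Function.Injective (Matrix.vecMulLinear G) := Matrix.vecMul_injective_iff.2 hG.1
  refine ⟨fun v => Matrix.vecMulLinear G (ψ v), hinj.comp hbij.1, ?_, ?_, ?_⟩
  · change Set.range (Matrix.vecMulLinear G ∘ ψ) = C
    rw [hbij.2.range_comp, ← LinearMap.coe_range, range_vecMulLinear, hG.2]
  · intro a v
    rw [hsmul, map_smul]
  · intro v
    rw [mem_traceDual_span hψ, LinearMap.BilinForm.mem_orthogonal_iff]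
    have hcol : ∀ j, traceDotForm F K k (G.col j) (ψ v) =
        Algebra.trace F K (Matrix.vecMulLinear G (ψ v) j) := by
      intro j
      rw [traceDotForm_apply, dotProduct_comm]
      rfl
    refine ⟨fun h j => (hcol j).symm.trans (h _ (Submodule.subset_span ⟨j, rfl⟩)),
      fun h u hu => ?_⟩
    induction hu using Submodule.span_induction with
    | mem u hu =>
      obtain ⟨j, rfl⟩ := hu
      exact (hcol j).trans (h j)
    | zero => simp
    | add y z _ _ hy hz => rw [map_add, LinearMap.add_apply, hy, hz, add_zero]
    | smul c y _ hy => rw [map_smul, LinearMap.smul_apply, hy, smul_zero]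

namespace IsDualEncoding

variable {τ : K →+* K} {C : Submodule K (Fin n → K)} {T : Submodule F (Fin k → K)}
  {e : (Fin k → K) → Fin n → K}

theorem mem (he : IsDualEncoding τ C T e) (v : Fin k → K) : e v ∈ C :=
  he.range_eq.le ⟨v, rfl⟩

theorem exists_eq (he : IsDualEncoding τ C T e) {c : Fin n → K} (hc : c ∈ C) : ∃ v, e v = c :=
  he.range_eq.ge hc

theorem map_zero (he : IsDualEncoding τ C T e) : e 0 = 0 := by
  simpa using he.map_smul 0 0

theorem map_ne_zero (he : IsDualEncoding τ C T e) {v : Fin k → K} : e v ≠ 0 ↔ v ≠ 0 := by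
  rw [← he.map_zero, he.injective.ne_iff]

/-- Scaling `v` by `τ a` scales its codeword by `a`, so membership becomes orthogonality of `a` to
the entries. -/
theorem smul_mem_iff (he : IsDualEncoding τ C T e) (a : K) (v : Fin k → K) :
    τ a • v ∈ T ↔ a ∈ traceOrthogonal (Submodule.span F (Set.range (e v))) := by
  rw [he.mem_iff, he.map_smul, mem_traceOrthogonal_span, Set.forall_mem_range]
  rfl

variable [Finite F] [Finite K]

theorem natCard_smul_mem (he : IsDualEncoding τ C T e) (v : Fin k → K) :
    Nat.card {a : K // a • v ∈ T} =
      Nat.card F ^ (Module.finrank F K - rankWeight F (e v)) := by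
  have hτ : Function.Bijective τ := Finite.injective_iff_bijective.1 τ.injective
  have hcard : Nat.card {a : K // a • v ∈ T} =
      Nat.card (traceOrthogonal (Submodule.span F (Set.range (e v)))) :=
    (Nat.card_congr ((Equiv.ofBijective τ hτ).subtypeEquiv
      fun a => (he.smul_mem_iff a v).symm)).symm
  have := finrank_add_finrank_traceOrthogonal (Submodule.span F (Set.range (e v)))
  rw [hcard, Module.natCard_eq_pow_finrank (K := F), rankWeight]
  congr 1
  omega

theorem pointWeight_eq (he : IsDualEncoding τ C T e) {v : Fin k → K} (hv : v ≠ 0) :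
    pointWeight T (Projectivization.mk K v hv) = Module.finrank F K - rankWeight F (e v) := by
  have hbij : Function.Bijective (fun a : {a : K // a • v ∈ T} =>
      (⟨a.1 • v, a.2, Submodule.smul_mem _ _ (Submodule.mem_span_singleton_self v)⟩ :
        ↥(T ⊓ (Projectivization.mk K v hv).submodule.restrictScalars F))) := by
    constructor
    · intro a b hab
      exact Subtype.ext (smul_left_injective K hv (congrArg Subtype.val hab))
    · rintro ⟨w, hw, hwv⟩
      obtain ⟨a, rfl⟩ := Submodule.mem_span_singleton.1 hwv
      exact ⟨⟨a, hw⟩, rfl⟩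
  have hcard := Nat.card_congr (Equiv.ofBijective _ hbij)
  rw [he.natCard_smul_mem, Module.natCard_eq_pow_finrank (K := F)
    (V := ↥(T ⊓ (Projectivization.mk K v hv).submodule.restrictScalars F))] at hcard
  exact (Nat.pow_right_injective (Finite.one_lt_card (α := F)) hcard).symm

theorem mk_mem_linearSet_iff (he : IsDualEncoding τ C T e) {v : Fin k → K} (hv : v ≠ 0) :
    Projectivization.mk K v hv ∈ linearSet K T ↔ rankWeight F (e v) < Module.finrank F K := by
  rw [← Nat.sub_pos_iff_lt, ← he.pointWeight_eq hv, pointWeight,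
    Module.finrank_pos_iff_exists_ne_zero]
  constructor
  · rintro ⟨u, huT, hu, huv⟩
    refine ⟨⟨u, huT, ?_⟩, fun h => hu (congrArg Subtype.val h)⟩
    rw [huv]
    exact Submodule.mem_span_singleton_self u
  · rintro ⟨⟨u, huT, huv⟩, hu⟩
    have hu0 : u ≠ 0 := fun h => hu (Subtype.ext h)
    obtain ⟨a, rfl⟩ := Submodule.mem_span_singleton.1 huv
    exact ⟨_, huT, hu0, ((Projectivization.mk_eq_mk_iff' K _ _ hu0 hv).2 ⟨a, rfl⟩).symm⟩

end IsDualEncoding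

end DualEncoding

/-! ### Clubs and club-type codes. -/

section Clubs

variable {F K : Type*} [Field F] [Field K] [Finite K] [Algebra F K]
  {q m n k d : ℕ} {C : Submodule K (Fin n → K)} {τ : K →+* K}
  {T : Submodule F (Fin k → K)} {e : (Fin k → K) → Fin n → K}

theorem natCard_subtype_eq_sum {α : Type*} [Fintype α] (p : α → Prop) [DecidablePred p] :
    Nat.card {a // p a} = ∑ a, if p a then 1 else 0 := by
  rw [Nat.card_eq_fintype_card, Fintype.card_subtype, Finset.card_filter]

/-- Count the pairs `(a, v)` with `a • v ∈ T` by `a`: zero contributes the whole space, and every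
other scalar contributes `|T|`. -/
theorem dvd_sum_natCard_smul_mem {N : ℕ} (hV : N ∣ Nat.card (Fin k → K)) (hT : N ∣ Nat.card T)
    [Fintype (Fin k → K)] :
    N ∣ ∑ v : Fin k → K, Nat.card {a : K // a • v ∈ T} := by
  classical
  have := Fintype.ofFinite K
  simp only [natCard_subtype_eq_sum]
  rw [Finset.sum_comm]
  refine Finset.dvd_sum fun a _ => ?_
  rw [← natCard_subtype_eq_sum]
  by_cases ha : a = 0
  · have : Nat.card {v : Fin k → K // a • v ∈ T} = Nat.card (Fin k → K) :=
      Nat.card_congr (Equiv.subtypeUnivEquiv fun v => by simp [ha])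
    rwa [this]
  · have : Nat.card {v : Fin k → K // a • v ∈ T} = Nat.card T :=
      Nat.card_congr ((MulAction.toPerm (Units.mk0 a ha)).subtypeEquiv fun v => Iff.rfl)
    rwa [this]

variable [Finite F]

theorem IsDualEncoding.isClub (he : IsDualEncoding τ C T e) (hq : Nat.card F = q)
    (hm : Module.finrank F K = m) (hC : IsCode F n k d C) (h : IsClubTypeCode F q m d C) :
    (linearSet K T).Nontrivial ∧ IsClub K (m - d) T := by
  obtain ⟨hdm, hweights⟩ := h.weights hm hC
  have hd := hC.pos
  obtain ⟨c₀, hc₀, h0, hw⟩ := hC.exists_rankWeight_eq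
  obtain ⟨v₀, rfl⟩ := he.exists_eq hc₀
  have hv₀ := he.map_ne_zero.1 h0
  obtain ⟨c₁, hc₁, hw₁⟩ := exists_of_weightCount_ne_zero h.2.2.1
  obtain ⟨v₁, rfl⟩ := he.exists_eq hc₁
  have hv₁ : v₁ ≠ 0 := by
    rintro rfl
    rw [he.map_zero, rankWeight_zero] at hw₁
    omega
  have hP : Projectivization.mk K v₀ hv₀ ∈ linearSet K T :=
    (he.mk_mem_linearSet_iff hv₀).2 (by omega)
  have hPw := he.pointWeight_eq hv₀
  have hQw := he.pointWeight_eq hv₁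
  refine ⟨⟨_, hP, _, (he.mk_mem_linearSet_iff hv₁).2 (by omega), fun heq => ?_⟩,
    _, hP, by rw [hPw, hm, hw], ?_⟩
  · rw [← heq, hPw] at hQw
    omega
  · intro Q hQ hne
    induction Q using Projectivization.ind with
    | h v hv =>
      rw [he.mk_mem_linearSet_iff] at hQ
      rw [he.pointWeight_eq]
      rcases hweights (e v) (he.mem v) (he.map_ne_zero.2 hv) with h1 | h1 | h1
      · omega
      · omega
      · obtain ⟨a, ha⟩ := exists_eq_smul_of_weightCount_eq hq hm hc₀ h0
          (hw.symm ▸ h.2.2.2) (he.mem v) (h1.trans hw.symm)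
        rw [← he.map_smul] at ha
        exact absurd ((Projectivization.mk_eq_mk_iff' K _ _ hv hv₀).2
          ⟨τ a, (he.injective ha).symm⟩) hne

/-- A club whose distinguished point does not have full weight does not cover the whole projective
space. -/
theorem IsDualEncoding.exists_rankWeight_eq_finrank (he : IsDualEncoding τ C T e)
    (hm : Module.finrank F K = m) (hd : 0 < d) (hdm : d + 2 ≤ m) (hk : 0 < k)
    {v₀ : Fin k → K} (hT : m - d < Module.finrank F T)
    (hin : ∀ v ∈ Submodule.span K {v₀}, v ≠ 0 → rankWeight F (e v) = d)
    (hout : ∀ v ∉ Submodule.span K {v₀}, rankWeight F (e v) = m ∨ rankWeight F (e v) = m - 1)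
    (hv₀ : v₀ ≠ 0) :
    ∃ v, rankWeight F (e v) = m := by
  classical
  by_contra! hne
  have := Fintype.ofFinite K
  set q := Nat.card F with hq
  have hq1 : 1 < q := Finite.one_lt_card
  have hcV : Nat.card (Fin k → K) = q ^ (k * m) := by
    rw [Module.natCard_eq_pow_finrank (K := F), Module.finrank_pi_fintype]
    simp [hm, hq]
  have hdvd_m : q ^ (m - d + 1) ∣ q ^ m := pow_dvd_pow q (by omega)
  have hdvd_V : q ^ (m - d + 1) ∣ Nat.card (Fin k → K) := by
    rw [hcV]
    exact hdvd_m.trans (pow_dvd_pow q (Nat.le_mul_of_pos_left m hk))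
  have hdvd := dvd_sum_natCard_smul_mem (T := T) hdvd_V (by
    rw [Module.natCard_eq_pow_finrank (K := F)]
    exact pow_dvd_pow q hT)
  let S : Finset (Fin k → K) := {v | v ∈ Submodule.span K {v₀}}
  have hS0 : (0 : Fin k → K) ∈ S := by simp [S]
  have hScard : S.card = q ^ m := by
    have h1 : S.card = Nat.card (Submodule.span K {v₀}) := by
      rw [Nat.card_eq_fintype_card, ← Fintype.card_subtype]
    rw [h1, Module.natCard_eq_pow_finrank (K := K), finrank_span_singleton hv₀, pow_one,
      Module.natCard_eq_pow_finrank (K := F), hm]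
  rw [← Finset.sum_add_sum_compl S, ← Finset.add_sum_erase S _ hS0] at hdvd
  -- Counted by `v`, this is the only contribution not divisible by `q^(m-d+1)` if weight `m` never
  -- occurs; divisibility of the total then gives `q ∣ q^m - 1`.
  have hsumS : ∑ v ∈ S.erase 0, Nat.card {a : K // a • v ∈ T} = (q ^ m - 1) * q ^ (m - d) := by
    rw [Finset.sum_congr rfl fun v hv => ?_, Finset.sum_const, Finset.card_erase_of_mem hS0,
      hScard, smul_eq_mul]
    rw [Finset.mem_erase, Finset.mem_filter] at hv
    rw [he.natCard_smul_mem, hin v hv.2.2 hv.1, hm]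
  have hsumC : ∑ v ∈ Sᶜ, Nat.card {a : K // a • v ∈ T} = Sᶜ.card * q := by
    rw [Finset.sum_congr rfl fun v hv => ?_, Finset.sum_const, smul_eq_mul]
    have hv' : v ∉ Submodule.span K {v₀} := by simpa [S] using hv
    rw [he.natCard_smul_mem, (hout v hv').resolve_left (hne v), hm,
      show m - (m - 1) = 1 by omega, pow_one]
  have hzero : Nat.card {a : K // a • (0 : Fin k → K) ∈ T} = q ^ m := by
    rw [he.natCard_smul_mem, he.map_zero, rankWeight_zero, hm, Nat.sub_zero]
  have hdvd_C : q ^ (m - d + 1) ∣ Sᶜ.card * q := by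
    refine Dvd.dvd.mul_right ?_ q
    rw [Finset.card_compl, hScard, ← Nat.card_eq_fintype_card]
    exact Nat.dvd_sub hdvd_V hdvd_m
  rw [hsumS, hsumC, hzero, Nat.dvd_add_left hdvd_C, Nat.dvd_add_right hdvd_m, pow_succ',
    Nat.mul_dvd_mul_iff_right (Nat.pow_pos (by omega))] at hdvd
  have h1 : q ∣ q ^ m := dvd_pow_self q (by omega)
  have h2 : q ∣ 1 := by
    have := (Nat.dvd_sub h1 hdvd)
    rwa [Nat.sub_sub_self (Nat.one_le_pow _ _ (by omega))] at this
  exact hq1.ne' (Nat.dvd_one.1 h2)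

theorem IsDualEncoding.isClubTypeCode (he : IsDualEncoding τ C T e) (hq : Nat.card F = q)
    (hm : Module.finrank F K = m) (hC : IsCode F n k d C) (hdm : d + 2 ≤ m)
    (hnt : (linearSet K T).Nontrivial) (hclub : IsClub K (m - d) T) :
    IsClubTypeCode F q m d C := by
  have hd := hC.pos
  obtain ⟨P, hP, hPw, hclub⟩ := hclub
  obtain ⟨Q, hQ, hQP⟩ := hnt.exists_ne P
  induction P using Projectivization.ind with | h v₀ hv₀ => ?_
  have hmk : ∀ v (hv : v ≠ 0), Projectivization.mk K v hv = Projectivization.mk K v₀ hv₀ ↔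
      v ∈ Submodule.span K {v₀} := fun v hv => by
    rw [Projectivization.mk_eq_mk_iff', Submodule.mem_span_singleton]
  have hin : ∀ v ∈ Submodule.span K {v₀}, v ≠ 0 → rankWeight F (e v) = d := by
    intro v hv hv0
    rw [← (hmk v hv0).2 hv, he.pointWeight_eq, hm] at hPw
    have := hm ▸ rankWeight_le_finrank (F := F) (e v)
    omega
  have hout : ∀ v ∉ Submodule.span K {v₀},
      rankWeight F (e v) = m ∨ rankWeight F (e v) = m - 1 := by
    intro v hv
    have hv0 : v ≠ 0 := fun h => hv (h ▸ Submodule.zero_mem _)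
    have hle := hm ▸ rankWeight_le_finrank (F := F) (e v)
    refine or_iff_not_imp_left.2 fun hne => ?_
    have := hclub _ ((he.mk_mem_linearSet_iff hv0).2 (by omega)) fun h => hv ((hmk v hv0).1 h)
    rw [he.pointWeight_eq, hm] at this
    omega
  -- A second point of `L_T` shows that `T` is not contained in the distinguished point.
  have hT : m - d < Module.finrank F T := by
    obtain ⟨u, huT, hu, rfl⟩ := hQ
    rw [← hPw]
    refine Submodule.finrank_lt_finrank_of_lt (lt_of_le_of_ne inf_le_left fun h => ?_)
    exact hQP ((hmk u hu).2 (h.ge huT).2)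
  obtain ⟨v₂, hw₂⟩ := he.exists_rankWeight_eq_finrank hm hd hdm hC.dim_pos hT hin hout hv₀
  obtain ⟨v₁, hw₁⟩ : ∃ v, rankWeight F (e v) = m - 1 := by
    induction Q using Projectivization.ind with
    | h v hv =>
      refine ⟨v, ?_⟩
      have := hclub _ hQ hQP
      rw [he.pointWeight_eq, hm] at this
      omega
  have hw₀ := hin v₀ (Submodule.mem_span_singleton_self v₀) hv₀
  have hne0 : ∀ v, rankWeight F (e v) ≠ 0 → e v ≠ 0 := fun v h h0 =>
    h (by rw [h0, rankWeight_zero])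
  refine ⟨Set.ncard_eq_three.2 ⟨m, m - 1, d, by omega, by omega, by omega, ?_⟩,
    hw₂ ▸ weightCount_ne_zero (he.mem v₂), hw₁ ▸ weightCount_ne_zero (he.mem v₁), ?_⟩
  · apply Set.Subset.antisymm
    · rintro _ ⟨c, hc, h0, rfl⟩
      obtain ⟨v, rfl⟩ := he.exists_eq hc
      by_cases hv : v ∈ Submodule.span K {v₀}
      · exact Or.inr (Or.inr (hin v hv (he.map_ne_zero.1 h0)))
      · exact (hout v hv).imp_right Or.inl
    · rintro i (rfl | rfl | rfl)
      · exact ⟨e v₂, he.mem v₂, hne0 _ (by omega), hw₂.symm⟩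
      · exact ⟨e v₁, he.mem v₁, hne0 _ (by omega), hw₁.symm⟩
      · exact ⟨e v₀, he.mem v₀, hne0 _ (by omega), hw₀.symm⟩
  · rw [← ncard_image_smul hq hm (hne0 v₀ (by omega)), weightCount]
    congr 1
    apply Set.Subset.antisymm
    · rintro c ⟨hc, hw⟩
      obtain ⟨v, rfl⟩ := he.exists_eq hc
      have hv : v ∈ Submodule.span K {v₀} := by
        by_contra hv
        have := hout v hv
        omega
      obtain ⟨b, rfl⟩ := Submodule.mem_span_singleton.1 hv
      obtain ⟨a, rfl⟩ := (Finite.injective_iff_surjective.1 τ.injective) b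
      refine ⟨a, ?_, (he.map_smul a v₀).symm⟩
      rintro rfl
      rw [he.map_smul, zero_smul, rankWeight_zero] at hw
      omega
    · rintro _ ⟨a, ha, rfl⟩
      exact ⟨C.smul_mem a (he.mem v₀), (rankWeight_smul ha _).trans hw₀⟩

end Clubs

end RankMetric

theorem mainTheorem9
    {F K : Type*} [Field F] [Finite F] [Field K] [Finite K] [Algebra F K]
    (q m n k d : ℕ) (hq : Nat.card F = q) (hm : Module.finrank F K = m)
    (C : Submodule K (Fin n → K)) (hC : RankMetric.IsCode F n k d C)
    (hnd : RankMetric.IsNondegenerate F C)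
    (U : Submodule F (Fin k → K)) (hU : RankMetric.IsAssociatedSystem F C U)
    (τ : K →+* K) (σ : (Fin k → K) →ₛₗ[τ] (Fin k → K) →ₗ[K] K)
    (hσ : σ.Nondegenerate) (hrefl : σ.IsRefl) :
    (RankMetric.IsClubTypeCode F q m d C ↔
      d + 2 ≤ m ∧
      (RankMetric.linearSet K (RankMetric.traceDual σ U)).Nontrivial ∧
      RankMetric.IsClub K (m - d) (RankMetric.traceDual σ U) ∧
      RankMetric.linearSetRank (RankMetric.traceDual σ U) = k * m - n) ∧
    (RankMetric.IsClubTypeCode F q m d C →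
      (((m : ℝ) / 2 ≤ d ∨ k = 2) → (m : ℝ) * k / 2 ≤ n) ∧
      ((1 ≤ d ∧ (d : ℝ) ≤ (m : ℝ) / 2) → (m : ℝ) * (k + 1) / 2 - m + d ≤ n)) := by
  obtain ⟨G, hG, rfl⟩ := hU
  obtain ⟨e, he⟩ := RankMetric.exists_isDualEncoding (F := F) τ σ hσ hG
  have hrank : RankMetric.linearSetRank (RankMetric.traceDual σ (RankMetric.columnSpan F G)) =
      k * m - n := by
    obtain rfl := hC.finrank_eq
    rw [RankMetric.linearSetRank, RankMetric.finrank_traceDual τ σ hσ, hnd G hG, hm]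
  refine ⟨⟨fun h => ?_, fun ⟨hdm, hnt, hclub, _⟩ => he.isClubTypeCode hq hm hC hdm hnt hclub⟩,
    fun h => ⟨?_, ?_⟩⟩
  · obtain ⟨hnt, hclub⟩ := he.isClub hq hm hC h
    exact ⟨(h.weights hm hC).1, hnt, hclub, hrank⟩
  · intro hor
    have hle : m * k ≤ 2 * n := by
      rcases hor with hmd | rfl
      · refine h.mul_le_two_mul_length hq hm hC ?_
        rw [div_le_iff₀ two_pos, mul_comm] at hmd
        exact_mod_cast hmd
      -- For `k = 2` the bound reads `m ≤ n`, which holds because a codeword of weight `m` has at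
      -- least `m` entries.
      · obtain ⟨c, -, hc⟩ := RankMetric.exists_of_weightCount_ne_zero h.2.1
        have := RankMetric.rankWeight_le_length (F := F) c
        omega
    rw [div_le_iff₀ two_pos, mul_comm (n : ℝ)]
    exact_mod_cast hle
  · rintro ⟨-, hmd⟩
    have hle : m * k + 2 * d ≤ 2 * n + m := by
      refine h.mul_add_two_mul_le hq hm hC ?_
      rw [le_div_iff₀ two_pos, mul_comm] at hmd
      exact_mod_cast hmd
    have hle' : (m : ℝ) * k + 2 * d ≤ 2 * n + m := by exact_mod_cast hle
    linarith
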